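/- Let $M$ be a $C^\infty$ manifold of dimension $n\neq 1$, $TM_0=TM\setminus\{0\}$, $\pi:TM_0\to M$ the projection, and let $F:TM\to[0,\infty)$ be a Finsler structure on $M$: $F$ is $C^\infty$ on $TM_0$, positively $1$-homogeneous on the fibres, and $g_{ij}(x,y)=\frac12[F^2]_{y^iy^j}$ is positive definite on $TM_0$. $F$ is called Riemannian if in all local coordinates the $g_{ij}(x,y)$ do not depend on $y\neq0$. Let $A_{ijk}=\frac12F\,\partial g_{ij}/\partial y^k=\frac14F[F^2]_{y^iy^jy^k}$ be the Cartan tensor, $\ell=y/F$ the canonical section of $\pi^*TM$, and $\rho:T(TM_0)\to\pi^*TM$, $\rho(\hat X)=\pi_*\hat X$. Let $D$ be a smooth linear connection on $\pi^*TM$ and put $\mu(\hat X)=D_{\hat X}(F\ell)$. $D$ is a Finsler connection if at each $z\in TM_0$ the map $\mu_z$ is an isomorphism of the vertical space $V_z=\ker\rho_z$ onto $T_{\pi z}M$; then $T_zTM_0=H_z\oplus V_z$ with $H_z=\ker\mu_z$. Let $\bar\ell$ be the horizontal field with $\rho(\bar\ell)=\ell$, and let $A^{(0)}=A$ and $A^{(i+1)}=D_{\bar\ell}A^{(i)}$,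 i.e. $$A^{(i+1)}(X,Y,Z)=\bar\ell\,A^{(i)}(X,Y,Z)-A^{(i)}(D_{\bar\ell}X,Y,Z)-A^{(i)}(X,D_{\bar\ell}Y,Z)-A^{(i)}(X,Y,D_{\bar\ell}Z);$$ write $\dot A=A^{(1)}$. Let $m\ge0$ and $\kappa_1,\dots,\kappa_m\in\mathbb R$. $D$ is called a Shen-type connection (with coefficients $\kappa_1,\dots,\kappa_m$) if it is a Finsler connection and, with $S=\kappa_1\dot A+\cdots+\kappa_mA^{(m)}$, $$D_{\hat X}\rho(\hat Y)-D_{\hat Y}\rho(\hat X)-\rho[\hat X,\hat Y]=0,$$ $$(D_{\hat Z}g)(X,Y)=2A(\rho(\hat Z),X,Y)+2F^{-1}A(\mu(\hat Z),X,Y)-2S(\rho(\hat Z),X,Y)$$ for all vector fields $\hat X,\hat Y,\hat Z$ on $TM_0$ and all sections $X,Y$ of $\pi^*TM$. **Theorem.** For every Shen-type connection $D$ on $(M,F)$, the hv-curvature of $D$, i.e. the restriction of its curvature $\Omega(\hat X,\hat Y)=D_{\hat X}D_{\hat Y}-D_{\hat Y}D_{\hat X}-D_{[\hat X,\hat Y]}$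 to horizontal $\hat X$ and vertical $\hat Y$, vanishes identically on $TM_0$ if and only if $F$ is Riemannian. -/

import Mathlib

open scoped Manifold ContDiff

namespace Finsler

noncomputable section

/-- The model space `ℝⁿ`. -/
abbrev E (n : ℕ) := EuclideanSpace ℝ (Fin n)

section Basic

variable (n : ℕ) (M : Type*) [TopologicalSpace M]

/-- The charts of the (maximal) `C^∞` atlas of `M`. -/
abbrev charts [ChartedSpace (E n) M] : Set (OpenPartialHomeomorph M (E n)) := IsManifold.maximalAtlas (𝓡 n) ∞ M

variable {n M}

/-- The domain in `ℝⁿ × ℝⁿ` of the coordinates `(x, y)` of `TM₀` that a chart of `M` induces: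
`x` in the image of the chart and `y ≠ 0`. -/
def slitDomain (φ : OpenPartialHomeomorph M (E n)) : Set (E n × E n) :=
  {z | z.1 ∈ φ.target ∧ z.2 ≠ 0}

theorem isOpen_slitDomain (φ : OpenPartialHomeomorph M (E n)) : IsOpen (slitDomain φ) :=
  (φ.open_target.preimage continuous_fst).inter (isOpen_ne.preimage continuous_snd)

/-- A function on `TM` in the coordinates `(x, y)` induced by a chart `φ`:
its value at the tangent vector `yⁱ ∂/∂xⁱ` at the point `φ⁻¹(x)`. -/
def localRep [ChartedSpace (E n) M] (F : TangentBundle (𝓡 n) M → ℝ) (φ : OpenPartialHomeomorph M (E n))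
    (z : E n × E n) : ℝ :=
  F ⟨φ.symm z.1, mfderiv (𝓡 n) (𝓡 n) φ.symm z.1 z.2⟩

/-- The derivative in the fibre direction `u`, i.e. `uⁱ ∂f/∂yⁱ`. -/
def vderiv (f : E n × E n → ℝ) (u : E n) (z : E n × E n) : ℝ :=
  fderiv ℝ f z (0, u)

/-- `g(u, v) = ½ [F²]_{yⁱ yʲ} uⁱ vʲ`, for a function `F` of `(x, y)`. -/
def halfHessian (F : E n × E n → ℝ) (z : E n × E n) (u v : E n) : ℝ :=
  (1 / 2) * vderiv (vderiv (fun z' => F z' ^ 2) u) v z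

end Basic

/-- A Finsler structure on the manifold `M`. -/
structure FinslerStructure (n : ℕ) (M : Type*) [TopologicalSpace M] [ChartedSpace (E n) M]
    [IsManifold (𝓡 n) ∞ M] where
  /-- the function `F` on `TM` -/
  toFun : TangentBundle (𝓡 n) M → ℝ
  nonneg : ∀ v, 0 ≤ toFun v
  smooth : ContMDiffOn (𝓡 n).tangent 𝓘(ℝ, ℝ) ∞ toFun {v | v.2 ≠ 0}
  homogeneous : ∀ (p : M) (y : TangentSpace (𝓡 n) p) (t : ℝ), 0 < t →
    toFun ⟨p, t • y⟩ = t * toFun ⟨p, y⟩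
  posDef : ∀ φ ∈ charts n M, ∀ z ∈ slitDomain φ, ∀ u : E n, u ≠ 0 →
    0 < halfHessian (localRep toFun φ) z u u

/-- A (smooth) linear connection on the bundle `π^*TM` over `TM₀`, given by its connection forms.
A chart `φ` of `M` induces the coordinates `(x, y)` on `TM₀` and the frame `∂ᵢ` of `π^*TM`; in these
a vector tangent to `TM₀` is a pair `u = (u.1, u.2)`, standing for
`u.1ⁱ ∂/∂xⁱ + u.2ⁱ ∂/∂yⁱ`, a section of `π^*TM` is an `ℝⁿ`-valued function `Y`, and
`∇_u Y = dY(u) + connForm φ z u (Y z)` at `z = (x, y)`. Only the values of `connForm` at charts of the smooth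
atlas, on the domain of the coordinates, have a meaning. -/
structure PullbackConnection (n : ℕ) (M : Type*) [TopologicalSpace M] [ChartedSpace (E n) M]
    [IsManifold (𝓡 n) ∞ M] where
  /-- the connection form in each chart -/
  connForm : OpenPartialHomeomorph M (E n) → E n × E n → (E n × E n) →L[ℝ] E n →L[ℝ] E n
  smooth : ∀ φ ∈ charts n M, ContDiffOn ℝ ∞ (connForm φ) (slitDomain φ)
  /-- Change of charts. If `τ` is the transition map and `J` its Jacobian, then `(x, y)` becomes
  `(τ x, J y)`, a section `Y` becomes `J Y`, and `∇_u Y` has to become `J (∇_u Y)`. -/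
  transition : ∀ φ ∈ charts n M, ∀ ψ ∈ charts n M, ∀ z ∈ slitDomain φ, φ.symm z.1 ∈ ψ.source →
    ∀ (u : E n × E n) (Y : E n),
      let τ : E n → E n := fun x => ψ (φ.symm x)
      let Tτ : E n × E n → E n × E n := fun w => (τ w.1, fderiv ℝ τ w.1 w.2)
      fderiv ℝ (fderiv ℝ τ) z.1 u.1 Y + connForm ψ (Tτ z) (fderiv ℝ Tτ z u) (fderiv ℝ τ z.1 Y) =
        fderiv ℝ τ z.1 (connForm φ z u Y)

variable {n : ℕ} {M : Type*} [TopologicalSpace M] [ChartedSpace (E n) M] [IsManifold (𝓡 n) ∞ M]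

namespace FinslerStructure

variable (F : FinslerStructure n M) (φ : OpenPartialHomeomorph M (E n))

/-- `F` in the coordinates `(x, y)`. -/
def loc (z : E n × E n) : ℝ := localRep F.toFun φ z

/-- The fundamental tensor `g_{ij}(x, y)`. -/
def g (z : E n × E n) (u v : E n) : ℝ := halfHessian (F.loc φ) z u v

/-- The Cartan tensor `A_{ijk} = ½ F ∂g_{ij}/∂yᵏ = ¼ F [F²]_{yⁱ yʲ yᵏ}`. -/
def cartan (z : E n × E n) (u v w : E n) : ℝ :=
  (1 / 4) * F.loc φ z * vderiv (vderiv (vderiv (fun z' => F.loc φ z' ^ 2) u) v) w z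

/-- `F` is Riemannian: in all local coordinates the `g_{ij}(x, y)` are independent of `y ≠ 0`. -/
def IsRiemannian : Prop :=
  ∀ φ ∈ charts n M, ∀ x ∈ φ.target, ∀ y y' : E n, y ≠ 0 → y' ≠ 0 →
    ∀ u v : E n, F.g φ (x, y) u v = F.g φ (x, y') u v

end FinslerStructure

namespace PullbackConnection

variable (D : PullbackConnection n M) (φ : OpenPartialHomeomorph M (E n))

/-- The covariant derivative `D_X Y` of a section `Y` of `π^*TM` along a vector field `X`
on `TM₀`, in the coordinates of a chart. -/
def cov (X : E n × E n → E n × E n) (Y : E n × E n → E n) (z : E n × E n) : E n :=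
  fderiv ℝ Y z (X z) + D.connForm φ z (X z) (Y z)

/-- The torsion `D_X ρ(Y) - D_Y ρ(X) - ρ[X, Y]` for vector fields `X`, `Y` on `TM₀`. -/
def torsionField (X Y : E n × E n → E n × E n) (z : E n × E n) : E n :=
  D.cov φ X (fun z' => (Y z').1) z - D.cov φ Y (fun z' => (X z').1) z
    - (VectorField.lieBracket ℝ X Y z).1

/-- The curvature `D_X D_Y Z - D_Y D_X Z - D_{[X, Y]} Z` for vector fields `X`, `Y` on `TM₀` and a
section `Z` of `π^*TM`. -/
def curvatureField (X Y : E n × E n → E n × E n) (Z : E n × E n → E n) (z : E n × E n) : E n :=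
  D.cov φ X (D.cov φ Y Z) z - D.cov φ Y (D.cov φ X Z) z
    - D.cov φ (VectorField.lieBracket ℝ X Y) Z z

/-- The torsion tensor at `z`: vectors are extended by constant components, see
`torsionField_eq`. -/
def torsion (z u v : E n × E n) : E n :=
  D.torsionField φ (fun _ => u) (fun _ => v) z

/-- The curvature tensor at `z`: vectors are extended by constant components, see
`curvatureField_eq`. -/
def curvature (z u v : E n × E n) (ζ : E n) : E n :=
  D.curvatureField φ (fun _ => u) (fun _ => v) (fun _ => ζ) z

/-- `μ_z(u) = D_u (Fℓ)`, where `Fℓ` is the canonical section `(x, y) ↦ y`. -/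
def μ (z : E n × E n) : (E n × E n) →L[ℝ] E n :=
  fderiv ℝ (fun z' : E n × E n => z'.2) z + (D.connForm φ z).flip z.2

/-- The restriction of `μ_z` to the vertical space. -/
def μV (z : E n × E n) : E n →L[ℝ] E n :=
  (D.μ φ z).comp (ContinuousLinearMap.inr ℝ (E n) (E n))

/-- `D` is a Finsler connection: `μ_z` maps the vertical space isomorphically onto `T_xM`. -/
def IsFinslerConnection : Prop :=
  ∀ φ ∈ charts n M, ∀ z ∈ slitDomain φ, Function.Bijective (D.μV φ z)

/-- The vertical vector `u` with `μ_z(u) = Y` (for a Finsler connection). -/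
def verticalLift (z : E n × E n) (Y : E n) : E n × E n :=
  (0, (D.μV φ z).inverse Y)

/-- The horizontal vector `u`, i.e. `μ_z(u) = 0`, with `ρ(u) = X` (for a Finsler connection). -/
def horizontalLift (z : E n × E n) (X : E n) : E n × E n :=
  (X, 0) - D.verticalLift φ z (D.μ φ z (X, 0))

/-- The hv-curvature `P(X, Y)ζ`: the curvature of the horizontal vector over `X`
and the vertical vector that `μ` maps to `Y`, applied to `ζ`. -/
def hvCurvature (z : E n × E n) (X Y ζ : E n) : E n :=
  D.curvature φ z (D.horizontalLift φ z X) (D.verticalLift φ z Y) ζ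

/-- The hv-curvature vanishes identically on `TM₀`. -/
def HVCurvatureVanishes : Prop :=
  ∀ φ ∈ charts n M, ∀ z ∈ slitDomain φ, ∀ X Y ζ : E n, D.hvCurvature φ z X Y ζ = 0

variable (F : FinslerStructure n M)

/-- The horizontal vector field over `ℓ = y / F`. -/
def ellBar (z : E n × E n) : E n × E n :=
  D.horizontalLift φ z ((F.loc φ z)⁻¹ • z.2)

/-- The covariant derivative of a 3-tensor `B` on `π^*TM` along the horizontal field over `ℓ`. -/
def covEllBar (B : E n × E n → E n → E n → E n → ℝ) (z : E n × E n) (X Y Z : E n) : ℝ :=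
  fderiv ℝ (fun z' => B z' X Y Z) z (D.ellBar φ F z)
    - B z (D.cov φ (D.ellBar φ F) (fun _ => X) z) Y Z
    - B z X (D.cov φ (D.ellBar φ F) (fun _ => Y) z) Z
    - B z X Y (D.cov φ (D.ellBar φ F) (fun _ => Z) z)

/-- The iterated derivatives `A, Ȧ, Ä, …` of the Cartan tensor. -/
def cartanDeriv : ℕ → E n × E n → E n → E n → E n → ℝ
  | 0 => F.cartan φ
  | k + 1 => D.covEllBar φ F (cartanDeriv k)

/-- `(D_u g)(X, Y)`, with `X`, `Y` extended by constant components. -/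
def covMetric (z u : E n × E n) (X Y : E n) : ℝ :=
  fderiv ℝ (fun z' => F.g φ z' X Y) z u
    - F.g φ z (D.cov φ (fun _ => u) (fun _ => X) z) Y
    - F.g φ z X (D.cov φ (fun _ => u) (fun _ => Y) z)

/-- The torsion of `D` is the one prescribed by the 3-tensor `T`:
`𝒯(u, v) = F⁻¹ T(μ u, ρ v) - F⁻¹ T(μ v, ρ u)`, where `g(T(X, Y), Z) = T(X, Y, Z)`. -/
def HasTorsion (T : OpenPartialHomeomorph M (E n) → E n × E n → E n → E n → E n → ℝ) : Prop :=
  ∀ φ ∈ charts n M, ∀ z ∈ slitDomain φ, ∀ (u v : E n × E n) (Z : E n),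
    F.g φ z (D.torsion φ z u v) Z =
      (F.loc φ z)⁻¹ * T φ z (D.μ φ z u) v.1 Z - (F.loc φ z)⁻¹ * T φ z (D.μ φ z v) u.1 Z

/-- `D` is almost-compatible with `F`, with respect to the 3-tensors `S` and `T`:
`(D_u g)(X, Y) = 2 A(ρ u, X, Y) + 2 F⁻¹ A(μ u, X, Y) - 2 S(ρ u, X, Y) - 2 F⁻¹ T(μ u, X, Y)`. -/
def IsAlmostCompatible
    (S T : OpenPartialHomeomorph M (E n) → E n × E n → E n → E n → E n → ℝ) : Prop :=
  ∀ φ ∈ charts n M, ∀ z ∈ slitDomain φ, ∀ (u : E n × E n) (X Y : E n),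
    D.covMetric φ F z u X Y =
      2 * F.cartan φ z u.1 X Y + 2 * (F.loc φ z)⁻¹ * F.cartan φ z (D.μ φ z u) X Y
        - 2 * S φ z u.1 X Y - 2 * (F.loc φ z)⁻¹ * T φ z (D.μ φ z u) X Y

/-- `D` is a Shen-type connection with coefficients `κ₁, …, κ_m`: a Finsler connection with the
torsion and the almost-compatibility prescribed by `S = κ₁ Ȧ + ⋯ + κ_m A^{(m)}` and `T = 0`. -/
def IsShenType (m : ℕ) (κ : ℕ → ℝ) : Prop :=
  D.IsFinslerConnection ∧ D.HasTorsion F (fun _ _ _ _ _ => 0) ∧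
    D.IsAlmostCompatible F
      (fun φ z X Y Z => ∑ i ∈ Finset.Icc 1 m, κ i * D.cartanDeriv φ F i z X Y Z)
      (fun _ _ _ _ _ => 0)

/-- The torsion is a tensor: its value at `z` depends only on the values of the fields at `z`. -/
theorem torsionField_eq (X Y : E n × E n → E n × E n) (z : E n × E n)
    (hX : DifferentiableAt ℝ X z) (hY : DifferentiableAt ℝ Y z) :
    D.torsionField φ X Y z = D.torsion φ z (X z) (Y z) := by
  have hX1 : fderiv ℝ (fun z' => (X z').1) z =
      (ContinuousLinearMap.fst ℝ (E n) (E n)).comp (fderiv ℝ X z) := fderiv.fst hX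
  have hY1 : fderiv ℝ (fun z' => (Y z').1) z =
      (ContinuousLinearMap.fst ℝ (E n) (E n)).comp (fderiv ℝ Y z) := fderiv.fst hY
  simp only [torsion, torsionField, cov, VectorField.lieBracket, hX1, hY1]
  simp
  abel

/-- The curvature is a tensor: its value at `z` depends only on the values of the fields at `z`. -/
theorem curvatureField_eq (hφ : φ ∈ charts n M) (z : E n × E n) (hz : z ∈ slitDomain φ)
    (X Y : E n × E n → E n × E n) (Z : E n × E n → E n)
    (hX : DifferentiableAt ℝ X z) (hY : DifferentiableAt ℝ Y z) (hZ : ContDiffAt ℝ 2 Z z) :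
    D.curvatureField φ X Y Z z = D.curvature φ z (X z) (Y z) (Z z) := by
  have hω : DifferentiableAt ℝ (D.connForm φ) z :=
    ((D.smooth φ hφ).contDiffAt ((isOpen_slitDomain φ).mem_nhds hz)).differentiableAt (by simp)
  have hZ1 : DifferentiableAt ℝ Z z := hZ.differentiableAt (by simp)
  have hZ2 : DifferentiableAt ℝ (fderiv ℝ Z) z :=
    (hZ.fderiv_right (m := 1) (by norm_num)).differentiableAt (by simp)
  have hsym : ∀ u v, fderiv ℝ (fderiv ℝ Z) z u v = fderiv ℝ (fderiv ℝ Z) z v u :=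
    fun u v => hZ.isSymmSndFDerivAt (by simp) u v
  have key : ∀ (W : E n × E n → E n × E n), DifferentiableAt ℝ W z → ∀ u,
      fderiv ℝ (D.cov φ W Z) z u =
        fderiv ℝ (fderiv ℝ Z) z u (W z) + fderiv ℝ Z z (fderiv ℝ W z u)
        + (fderiv ℝ (D.connForm φ) z u (W z) (Z z) + D.connForm φ z (fderiv ℝ W z u) (Z z)
          + D.connForm φ z (W z) (fderiv ℝ Z z u)) := by
    intro W hW u
    have h1 := hZ2.hasFDerivAt.clm_apply hW.hasFDerivAt
    have h2 := (hω.hasFDerivAt.clm_apply hW.hasFDerivAt).clm_apply hZ1.hasFDerivAt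
    have h3 : fderiv ℝ (D.cov φ W Z) z = _ := (h1.add h2).fderiv
    rw [h3]
    simp
    abel
  have key2 : ∀ (w : E n × E n) (ζ : E n) u,
      fderiv ℝ (D.cov φ (fun _ => w) (fun _ => ζ)) z u = fderiv ℝ (D.connForm φ) z u w ζ := by
    intro w ζ u
    have h2 := (hω.hasFDerivAt.clm_apply (hasFDerivAt_const w z)).clm_apply (hasFDerivAt_const ζ z)
    have h3 : (D.cov φ (fun _ => w) (fun _ => ζ)) =
        fun z => D.connForm φ z w ζ := by
      funext z; simp [cov]
    rw [h3, h2.fderiv]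
    simp
  have e : ∀ (V W : E n × E n → E n × E n) (Q : E n × E n → E n),
      D.cov φ V (D.cov φ W Q) z = fderiv ℝ (D.cov φ W Q) z (V z)
        + D.connForm φ z (V z) (D.cov φ W Q z) := fun _ _ _ => rfl
  simp only [curvature, curvatureField, e, key X hX, key Y hY, key2]
  simp only [cov, VectorField.lieBracket]
  rw [hsym (X z) (Y z)]
  simp
  abel

end PullbackConnection

end

end Finsler

/-! Everything happens in a chart, with f = F² and Γ the connection form. Zero torsion makes Γ
vanish on vertical vectors and Γ(X)Y symmetric in X, Y. Hence `μ` is the identity on vertical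
vectors, the horizontal lift of X is h = (X, -Γ(X)y), and the hv-curvature is -∂Γ/∂y
(`hvCurvature_eq`). The theorem thus compares "Γ is independent of y" with "A = 0", the latter being
equivalent to F Riemannian because slit fibres are connected for n ≥ 2 (`isRiemannian_iff`).

If Γ is independent of y: every A^{(i)} annihilates y, so compatibility evaluated on (y, y) gives
df(h) = 0 for horizontal h. Differentiating this along the fibre two and three times yields D_h g =
0 and D_h(f_yyy) = 0. The latter gives Ȧ = 0, hence S = 0; compatibility in horizontal directions
then reads 0 = D_h g = 2A.

If A = 0: all A^{(i)} vanish, so S = 0 and D_h g = 0, where g does not depend on y. A fibre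
derivative of this identity shows that g(∂Γ(X)Y, Z) is skew in Y, Z; it is symmetric in X, Y by zero
torsion, so it vanishes by Koszul's argument. -/

set_option maxSynthPendingDepth 6

namespace Finsler

/-! ### Smoothness and homogeneity of F in chart coordinates. -/

section Coordinates

variable {n : ℕ} {M : Type*} [TopologicalSpace M] [ChartedSpace (E n) M]

/-- The identification of `E × E` with the tangent bundle of `E` is smooth. -/
theorem contMDiff_mk_tangentBundle :
    ContMDiff 𝓘(ℝ, E n × E n) (𝓡 n).tangent ∞
      (fun z : E n × E n => (⟨z.1, z.2⟩ : TangentBundle (𝓡 n) (E n))) := by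
  intro z
  rw [Bundle.contMDiffAt_totalSpace]
  refine ⟨contDiff_fst.contMDiff.contMDiffAt, ?_⟩
  have h : ContMDiffAt 𝓘(ℝ, E n × E n) 𝓘(ℝ, E n) ∞ (fun z : E n × E n => z.2) z :=
    contDiff_snd.contMDiff.contMDiffAt
  simpa [TangentBundle.trivializationAt_apply, chartAt_self_eq] using h

/-- Needed so that the coordinates in `slitDomain` stay off the zero section, the only place where F
need not be smooth. -/
theorem mfderiv_symm_ne_zero {φ : OpenPartialHomeomorph M (E n)} (hφ : φ ∈ charts n M)
    {x y : E n} (hx : x ∈ φ.target) (hy : y ≠ 0) :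
    mfderiv (𝓡 n) (𝓡 n) φ.symm x y ≠ 0 := by
  have hd : φ.MDifferentiable (𝓡 n) (𝓡 n) :=
    ⟨(contMDiffOn_of_mem_maximalAtlas hφ).mdifferentiableOn (by simp),
      (contMDiffOn_symm_of_mem_maximalAtlas hφ).mdifferentiableOn (by simp)⟩
  intro h
  refine hy ?_
  have h2 := congrArg (fun L => L y) (hd.comp_symm_deriv hx)
  have h3 : mfderiv (𝓡 n) (𝓡 n) φ (φ.symm x) (mfderiv (𝓡 n) (𝓡 n) φ.symm x y) = y := h2
  rw [← h3, h]
  exact map_zero _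

namespace FinslerStructure

variable [IsManifold (𝓡 n) ∞ M] (F : FinslerStructure n M) {φ : OpenPartialHomeomorph M (E n)}

theorem contDiffOn_loc (hφ : φ ∈ charts n M) : ContDiffOn ℝ ∞ (F.loc φ) (slitDomain φ) := by
  rw [← contMDiffOn_iff_contDiffOn]
  have h1 : ContMDiffOn (𝓡 n).tangent (𝓡 n).tangent ∞
      (tangentMapWithin (𝓡 n) (𝓡 n) φ.symm φ.target)
      (Bundle.TotalSpace.proj ⁻¹' φ.target) :=
    (contMDiffOn_symm_of_mem_maximalAtlas hφ).contMDiffOn_tangentMapWithin (by simp)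
      φ.open_target.uniqueMDiffOn
  have h2 : ContMDiffOn 𝓘(ℝ, E n × E n) (𝓡 n).tangent ∞
      (fun z : E n × E n => (⟨φ.symm z.1, mfderiv (𝓡 n) (𝓡 n) φ.symm z.1 z.2⟩ :
        TangentBundle (𝓡 n) M)) (slitDomain φ) := by
    refine (h1.comp contMDiff_mk_tangentBundle.contMDiffOn (fun z hz => hz.1)).congr ?_
    intro z hz
    simp only [Function.comp, tangentMapWithin]
    rw [mfderivWithin_of_mem_nhds (φ.open_target.mem_nhds hz.1)]
  exact F.smooth.comp h2 (fun z hz => mfderiv_symm_ne_zero hφ hz.1 hz.2)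

theorem loc_smul (z : E n × E n) {t : ℝ} (ht : 0 < t) :
    F.loc φ (z.1, t • z.2) = t * F.loc φ z := by
  have := F.homogeneous (φ.symm z.1) (mfderiv (𝓡 n) (𝓡 n) φ.symm z.1 z.2) t ht
  rw [loc, loc, localRep, localRep, ← this]
  congr 2
  exact map_smul _ _ _

end FinslerStructure

end Coordinates

/-! ### Iterated Fréchet derivatives on an open set and their symmetries. -/

section Calculus

variable {V G : Type*} [NormedAddCommGroup V] [NormedSpace ℝ V] [NormedAddCommGroup G]
  [NormedSpace ℝ G] {U : Set V} {z : V}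

theorem hasFDerivAt_of_contDiffOn {f : V → G} (hf : ContDiffOn ℝ ∞ f U) (hU : IsOpen U)
    (hz : z ∈ U) : HasFDerivAt f (fderiv ℝ f z) z :=
  ((hf.contDiffAt (hU.mem_nhds hz)).differentiableAt (by simp)).hasFDerivAt

theorem contDiffOn_fderiv {f : V → G} (hf : ContDiffOn ℝ ∞ f U) (hU : IsOpen U) :
    ContDiffOn ℝ ∞ (fderiv ℝ f) U :=
  hf.fderiv_of_isOpen hU (by simp)

theorem fderiv_congr_of_eqOn {f g : V → G} (h : Set.EqOn f g U) (hU : IsOpen U) (hz : z ∈ U) :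
    fderiv ℝ f z = fderiv ℝ g z :=
  (h.eventuallyEq_of_mem (hU.mem_nhds hz)).fderiv_eq

theorem fderiv_eq_zero_of_eqOn_zero {f : V → G} (h : ∀ w ∈ U, f w = 0) (hU : IsOpen U)
    (hz : z ∈ U) : fderiv ℝ f z = 0 := by
  rw [fderiv_congr_of_eqOn (g := fun _ => 0) h hU hz]
  simp

theorem fderiv_fderiv_comm {f : V → G} (hf : ContDiffOn ℝ ∞ f U) (hU : IsOpen U) (hz : z ∈ U)
    (u v : V) : fderiv ℝ (fderiv ℝ f) z u v = fderiv ℝ (fderiv ℝ f) z v u :=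
  (hf.contDiffAt (hU.mem_nhds hz)).isSymmSndFDerivAt
    (by simp; exact WithTop.coe_le_coe.2 le_top) u v

variable {W W' W'' : Type*} [NormedAddCommGroup W] [NormedSpace ℝ W] [NormedAddCommGroup W']
  [NormedSpace ℝ W'] [NormedAddCommGroup W''] [NormedSpace ℝ W'']

theorem fderiv_apply_const {T : V → W →L[ℝ] G} (hT : ContDiffOn ℝ ∞ T U) (hU : IsOpen U)
    (hz : z ∈ U) (u : W) (v : V) : fderiv ℝ (fun z' => T z' u) z v = fderiv ℝ T z v u := by
  rw [((hasFDerivAt_of_contDiffOn hT hU hz).clm_apply (hasFDerivAt_const u z)).fderiv]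
  simp

theorem fderiv_apply_const₂ {T : V → W →L[ℝ] W' →L[ℝ] G} (hT : ContDiffOn ℝ ∞ T U)
    (hU : IsOpen U) (hz : z ∈ U) (u : W) (u' : W') (v : V) :
    fderiv ℝ (fun z' => T z' u u') z v = fderiv ℝ T z v u u' := by
  rw [fderiv_apply_const (hT.clm_apply contDiffOn_const) hU hz, fderiv_apply_const hT hU hz]

theorem fderiv_apply_const₃ {T : V → W →L[ℝ] W' →L[ℝ] W'' →L[ℝ] G} (hT : ContDiffOn ℝ ∞ T U)
    (hU : IsOpen U) (hz : z ∈ U) (u : W) (u' : W') (u'' : W'') (v : V) :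
    fderiv ℝ (fun z' => T z' u u' u'') z v = fderiv ℝ T z v u u' u'' := by
  rw [fderiv_apply_const₂ (hT.clm_apply contDiffOn_const) hU hz, fderiv_apply_const hT hU hz]

/-- Differentiate the symmetry of the second derivative. With `fderiv_fderiv_comm` for the two outer
slots, this generates all permutations. -/
theorem fderiv_three_swap {f : V → G} (hf : ContDiffOn ℝ ∞ f U) (hU : IsOpen U) (hz : z ∈ U)
    (u v w : V) : fderiv ℝ (fderiv ℝ (fderiv ℝ f)) z u v w =
      fderiv ℝ (fderiv ℝ (fderiv ℝ f)) z u w v := by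
  have h2 := contDiffOn_fderiv (contDiffOn_fderiv hf hU) hU
  rw [← fderiv_apply_const₂ h2 hU hz, ← fderiv_apply_const₂ h2 hU hz]
  rw [fderiv_congr_of_eqOn (fun z' hz' => fderiv_fderiv_comm hf hU hz' v w) hU hz]

theorem fderiv_four_swap {f : V → G} (hf : ContDiffOn ℝ ∞ f U) (hU : IsOpen U) (hz : z ∈ U)
    (u v w x : V) : fderiv ℝ (fderiv ℝ (fderiv ℝ (fderiv ℝ f))) z u v w x =
      fderiv ℝ (fderiv ℝ (fderiv ℝ (fderiv ℝ f))) z u v x w := by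
  have h3 := contDiffOn_fderiv (contDiffOn_fderiv (contDiffOn_fderiv hf hU) hU) hU
  rw [← fderiv_apply_const₃ h3 hU hz, ← fderiv_apply_const₃ h3 hU hz]
  rw [fderiv_congr_of_eqOn (fun z' hz' => fderiv_three_swap hf hU hz' v w x) hU hz]

end Calculus

section Vertical

variable {n : ℕ} {U : Set (E n × E n)} {z : E n × E n} {f : E n × E n → ℝ}

theorem vderiv_vderiv (hf : ContDiffOn ℝ ∞ f U) (hU : IsOpen U) (hz : z ∈ U) (u v : E n) :
    vderiv (vderiv f u) v z = fderiv ℝ (fderiv ℝ f) z (0, v) (0, u) :=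
  fderiv_apply_const (contDiffOn_fderiv hf hU) hU hz _ _

theorem vderiv_vderiv_vderiv (hf : ContDiffOn ℝ ∞ f U) (hU : IsOpen U) (hz : z ∈ U)
    (u v w : E n) : vderiv (vderiv (vderiv f u) v) w z =
      fderiv ℝ (fderiv ℝ (fderiv ℝ f)) z (0, w) (0, v) (0, u) := by
  rw [← fderiv_apply_const₂ (contDiffOn_fderiv (contDiffOn_fderiv hf hU) hU) hU hz]
  exact congrArg (fun L => L (0, w))
    (fderiv_congr_of_eqOn (fun z' hz' => vderiv_vderiv hf hU hz' u v) hU hz)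

theorem hasFDerivAt_zero_snd (z : E n × E n) :
    HasFDerivAt (fun z' : E n × E n => ((0, z'.2) : E n × E n))
      ((ContinuousLinearMap.inr ℝ (E n) (E n)).comp (ContinuousLinearMap.snd ℝ (E n) (E n))) z :=
  ((ContinuousLinearMap.inr ℝ (E n) (E n)).comp
    (ContinuousLinearMap.snd ℝ (E n) (E n))).hasFDerivAt

end Vertical

/-! ### Euler relations for F², g and the Cartan tensor. -/

namespace FinslerStructure

variable {n : ℕ} {M : Type*} [TopologicalSpace M] [ChartedSpace (E n) M] [IsManifold (𝓡 n) ∞ M]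
variable (F : FinslerStructure n M) (φ : OpenPartialHomeomorph M (E n))

/-- `F²` in the coordinates `(x, y)`. -/
noncomputable def sq (z : E n × E n) : ℝ := F.loc φ z ^ 2

variable {φ} (hφ : φ ∈ charts n M) {z : E n × E n} (hz : z ∈ slitDomain φ)

include hφ

theorem contDiffOn_sq : ContDiffOn ℝ ∞ (F.sq φ) (slitDomain φ) :=
  (F.contDiffOn_loc hφ).pow 2

theorem contDiffOn_fderiv_sq : ContDiffOn ℝ ∞ (fderiv ℝ (F.sq φ)) (slitDomain φ) :=
  contDiffOn_fderiv (F.contDiffOn_sq hφ) (isOpen_slitDomain φ)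

theorem contDiffOn_fderiv_two_sq :
    ContDiffOn ℝ ∞ (fderiv ℝ (fderiv ℝ (F.sq φ))) (slitDomain φ) :=
  contDiffOn_fderiv (F.contDiffOn_fderiv_sq hφ) (isOpen_slitDomain φ)

theorem contDiffOn_fderiv_three_sq :
    ContDiffOn ℝ ∞ (fderiv ℝ (fderiv ℝ (fderiv ℝ (F.sq φ)))) (slitDomain φ) :=
  contDiffOn_fderiv (F.contDiffOn_fderiv_two_sq hφ) (isOpen_slitDomain φ)

include hz

theorem g_eq (u v : E n) :
    F.g φ z u v = 1 / 2 * fderiv ℝ (fderiv ℝ (F.sq φ)) z (0, v) (0, u) := by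
  rw [g, halfHessian, ← vderiv_vderiv (F.contDiffOn_sq hφ) (isOpen_slitDomain φ) hz]
  rfl

theorem cartan_eq (u v w : E n) : F.cartan φ z u v w =
    1 / 4 * F.loc φ z * fderiv ℝ (fderiv ℝ (fderiv ℝ (F.sq φ))) z (0, w) (0, v) (0, u) := by
  rw [cartan, ← vderiv_vderiv_vderiv (F.contDiffOn_sq hφ) (isOpen_slitDomain φ) hz]
  rfl

/-- Euler's relation: differentiate F²(x, ty) = t² F²(x, y) at t = 1. -/
theorem fderiv_sq_euler : fderiv ℝ (F.sq φ) z (0, z.2) = 2 * F.sq φ z := by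
  have h1 := hasFDerivAt_of_contDiffOn (F.contDiffOn_sq hφ) (isOpen_slitDomain φ) hz
  have h2 : HasDerivAt (fun t : ℝ => ((z.1, t • z.2) : E n × E n)) (0, z.2) 1 := by
    simpa using (hasDerivAt_const (1 : ℝ) z.1).prodMk ((hasDerivAt_id (1 : ℝ)).smul_const z.2)
  have h3 : HasDerivAt (fun t : ℝ => F.sq φ (z.1, t • z.2)) (fderiv ℝ (F.sq φ) z (0, z.2)) 1 :=
    HasFDerivAt.comp_hasDerivAt_of_eq (1 : ℝ) h1 h2 (by simp)
  have h4 : HasDerivAt (fun t : ℝ => t ^ 2 * F.sq φ z) (2 * F.sq φ z) 1 := by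
    simpa using (hasDerivAt_pow 2 (1 : ℝ)).mul_const (F.sq φ z)
  refine h3.unique (h4.congr_of_eventuallyEq ?_)
  filter_upwards [lt_mem_nhds one_pos] with t ht
  rw [sq, F.loc_smul z ht, sq, mul_pow]

/-- Derivative of Euler's relation along u, which may have an x-component. The subtracted term comes
from differentiating the argument (0, y). -/
theorem fderiv_two_sq_canonical (u : E n × E n) :
    fderiv ℝ (fderiv ℝ (F.sq φ)) z u (0, z.2) =
      2 * fderiv ℝ (F.sq φ) z u - fderiv ℝ (F.sq φ) z (0, u.2) := by
  have h1 := hasFDerivAt_of_contDiffOn (F.contDiffOn_fderiv_sq hφ) (isOpen_slitDomain φ) hz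
  have h2 := (h1.clm_apply (hasFDerivAt_zero_snd z)).fderiv
  rw [fderiv_congr_of_eqOn (fun z' hz' => F.fderiv_sq_euler hφ hz') (isOpen_slitDomain φ) hz] at h2
  have h3 := (hasFDerivAt_of_contDiffOn (F.contDiffOn_sq hφ) (isOpen_slitDomain φ) hz).const_mul 2
  rw [h3.fderiv] at h2
  have h4 := congrArg (fun L => L u) h2
  simp at h4
  linarith

theorem fderiv_two_sq_euler (u : E n) :
    fderiv ℝ (fderiv ℝ (F.sq φ)) z (0, u) (0, z.2) = fderiv ℝ (F.sq φ) z (0, u) := by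
  rw [F.fderiv_two_sq_canonical hφ hz]
  ring

/-- Differentiate `fderiv_two_sq_euler` along u. For vertical u the right side vanishes: A
annihilates y. -/
theorem fderiv_three_sq_canonical (u : E n × E n) (v : E n) :
    fderiv ℝ (fderiv ℝ (fderiv ℝ (F.sq φ))) z u (0, v) (0, z.2) =
      fderiv ℝ (fderiv ℝ (F.sq φ)) z u (0, v) -
        fderiv ℝ (fderiv ℝ (F.sq φ)) z (0, u.2) (0, v) := by
  have hU := isOpen_slitDomain φ
  have h1 := hasFDerivAt_of_contDiffOn ((F.contDiffOn_fderiv_two_sq hφ).clm_apply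
    (contDiffOn_const (c := ((0, v) : E n × E n)))) hU hz
  have h2 := (h1.clm_apply (hasFDerivAt_zero_snd z)).fderiv
  rw [fderiv_congr_of_eqOn (fun z' hz' => F.fderiv_two_sq_euler hφ hz' v) hU hz] at h2
  have h4 := congrArg (fun L => L u) h2
  rw [fderiv_apply_const (F.contDiffOn_fderiv_sq hφ) hU hz] at h4
  simp [fderiv_apply_const (F.contDiffOn_fderiv_two_sq hφ) hU hz] at h4
  rw [fderiv_fderiv_comm (F.contDiffOn_sq hφ) hU hz (0, v)] at h4
  linarith

theorem fderiv_three_sq_euler (u v : E n) :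
    fderiv ℝ (fderiv ℝ (fderiv ℝ (F.sq φ))) z (0, u) (0, v) (0, z.2) = 0 := by
  rw [F.fderiv_three_sq_canonical hφ hz, sub_self]

theorem g_self_canonical : F.g φ z z.2 z.2 = F.sq φ z := by
  rw [F.g_eq hφ hz, F.fderiv_two_sq_euler hφ hz, F.fderiv_sq_euler hφ hz]
  ring

/-- Positive definiteness applied to g(y, y) = F². -/
theorem loc_ne_zero : F.loc φ z ≠ 0 := by
  intro h
  have h1 : 0 < F.g φ z z.2 z.2 := F.posDef φ hφ z hz z.2 hz.2
  rw [F.g_self_canonical hφ hz, sq, h] at h1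
  simp at h1

theorem fderiv_g (u v : E n) (w : E n × E n) : fderiv ℝ (fun z' => F.g φ z' u v) z w =
    1 / 2 * fderiv ℝ (fderiv ℝ (fderiv ℝ (F.sq φ))) z w (0, v) (0, u) := by
  have hU := isOpen_slitDomain φ
  have h := hasFDerivAt_of_contDiffOn (((F.contDiffOn_fderiv_two_sq hφ).clm_apply
    (contDiffOn_const (c := ((0, v) : E n × E n)))).clm_apply
      (contDiffOn_const (c := ((0, u) : E n × E n)))) hU hz
  rw [fderiv_congr_of_eqOn (fun z' hz' => F.g_eq hφ hz' u v) hU hz, (h.const_mul _).fderiv,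
    ← fderiv_apply_const₂ (F.contDiffOn_fderiv_two_sq hφ) hU hz]
  rfl

theorem eq_zero_of_g_eq_zero {u : E n} (h : ∀ v, F.g φ z u v = 0) : u = 0 := by
  by_contra hu
  exact (F.posDef φ hφ z hz u hu).ne' (h u)

theorem cartan_eq_zero_iff (u v w : E n) : F.cartan φ z u v w = 0 ↔
    fderiv ℝ (fderiv ℝ (fderiv ℝ (F.sq φ))) z (0, w) (0, v) (0, u) = 0 := by
  rw [F.cartan_eq hφ hz]
  simp [F.loc_ne_zero hφ hz]

end FinslerStructure

/-! ### Connection, curvature and derived Cartan tensors in coordinates. -/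

namespace PullbackConnection

variable {n : ℕ} {M : Type*} [TopologicalSpace M] [ChartedSpace (E n) M] [IsManifold (𝓡 n) ∞ M]
variable {D : PullbackConnection n M} {F : FinslerStructure n M} {m : ℕ} {κ : ℕ → ℝ}
  {φ : OpenPartialHomeomorph M (E n)} {z : E n × E n}

theorem cov_const (w : E n × E n → E n × E n) (ζ : E n) :
    D.cov φ w (fun _ => ζ) = fun z => D.connForm φ z (w z) ζ := by
  funext z
  simp [cov]

theorem torsion_eq (u v : E n × E n) :
    D.torsion φ z u v = D.connForm φ z u v.1 - D.connForm φ z v u.1 := by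
  simp [torsion, torsionField, cov_const, VectorField.lieBracket]

theorem μ_apply (u : E n × E n) : D.μ φ z u = u.2 + D.connForm φ z u z.2 := by
  simp [μ, fderiv_snd]

/-- The derivative of a trilinear form along `ℓ̄`, as a trilinear form. -/
noncomputable def covEllBarCLM (L : E n × E n) (K : E n →L[ℝ] E n)
    (T : E n →L[ℝ] E n →L[ℝ] E n →L[ℝ] ℝ)
    (T' : (E n × E n) →L[ℝ] E n →L[ℝ] E n →L[ℝ] E n →L[ℝ] ℝ) :
    E n →L[ℝ] E n →L[ℝ] E n →L[ℝ] ℝ :=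
  T' L - T.comp K - ((ContinuousLinearMap.compL ℝ (E n) (E n) (E n →L[ℝ] ℝ)).flip K).comp T
    - (ContinuousLinearMap.compL ℝ (E n) (E n →L[ℝ] ℝ) (E n →L[ℝ] ℝ)
        ((ContinuousLinearMap.compL ℝ (E n) (E n) ℝ).flip K)).comp T

theorem covEllBarCLM_apply (L : E n × E n) (K : E n →L[ℝ] E n)
    (T : E n →L[ℝ] E n →L[ℝ] E n →L[ℝ] ℝ)
    (T' : (E n × E n) →L[ℝ] E n →L[ℝ] E n →L[ℝ] E n →L[ℝ] ℝ) (X Y Z : E n) :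
    covEllBarCLM L K T T' X Y Z = T' L X Y Z - T (K X) Y Z - T X (K Y) Z - T X Y (K Z) := by
  simp [covEllBarCLM]

/-- The Cartan tensor at `z` as a trilinear form. -/
noncomputable def cartanCLM (F : FinslerStructure n M) (φ : OpenPartialHomeomorph M (E n))
    (z : E n × E n) : E n →L[ℝ] E n →L[ℝ] E n →L[ℝ] ℝ :=
  let i := ContinuousLinearMap.inr ℝ (E n) (E n)
  let P := (ContinuousLinearMap.compL ℝ (E n) (E n × E n) ℝ).flip i
  let Q := (ContinuousLinearMap.compL ℝ (E n) (E n × E n) (E n →L[ℝ] ℝ)).flip i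
  (1 / 4 * F.loc φ z) • ((Q.comp
    (ContinuousLinearMap.compL ℝ (E n × E n) ((E n × E n) →L[ℝ] ℝ) (E n →L[ℝ] ℝ) P)).comp
      (fderiv ℝ (fderiv ℝ (fderiv ℝ (F.sq φ))) z)).comp i

theorem cartanCLM_apply (X Y Z : E n) : cartanCLM F φ z X Y Z =
    1 / 4 * F.loc φ z * fderiv ℝ (fderiv ℝ (fderiv ℝ (F.sq φ))) z (0, X) (0, Y) (0, Z) := by
  simp [cartanCLM]

/-- One step of the recursion for A^{(i)}, for a tensor with a smooth multilinear representative, so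
that multilinearity and smoothness can be carried through an induction. -/
theorem covEllBar_eq {B : E n × E n → E n → E n → E n → ℝ} {T : E n × E n → E n →L[ℝ] E n →L[ℝ] E n →L[ℝ] ℝ}
    (hT : ContDiffOn ℝ ∞ T (slitDomain φ))
    (hB : ∀ z ∈ slitDomain φ, ∀ X Y Z, B z X Y Z = T z X Y Z)
    (hz : z ∈ slitDomain φ) (X Y Z : E n) :
    D.covEllBar φ F B z X Y Z =
      covEllBarCLM (D.ellBar φ F z) (D.connForm φ z (D.ellBar φ F z)) (T z) (fderiv ℝ T z)
        X Y Z := by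
  have hU := isOpen_slitDomain φ
  rw [covEllBarCLM_apply, covEllBar, fderiv_congr_of_eqOn (fun z' hz' => hB z' hz' X Y Z) hU hz,
    fderiv_apply_const₃ hT hU hz]
  simp only [cov_const, hB z hz]

variable (hφ : φ ∈ charts n M)

include hφ

theorem contDiffOn_connForm : ContDiffOn ℝ ∞ (D.connForm φ) (slitDomain φ) := D.smooth φ hφ

theorem curvature_eq (hz : z ∈ slitDomain φ) (u v : E n × E n) (ζ : E n) :
    D.curvature φ z u v ζ = fderiv ℝ (D.connForm φ) z u v ζ - fderiv ℝ (D.connForm φ) z v u ζ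
      + (D.connForm φ z u (D.connForm φ z v ζ) - D.connForm φ z v (D.connForm φ z u ζ)) := by
  have h := D.contDiffOn_connForm hφ
  have hU := isOpen_slitDomain φ
  simp only [curvature, curvatureField, cov_const]
  simp only [cov, VectorField.lieBracket, fderiv_apply_const₂ h hU hz]
  simp
  abel

/-! ### Consequences of zero torsion. -/

section Shen

variable (hD : D.IsShenType F m κ)

include hD

theorem IsShenType.torsion_eq_zero (hz : z ∈ slitDomain φ) (u v : E n × E n) :
    D.torsion φ z u v = 0 :=
  F.eq_zero_of_g_eq_zero hφ hz fun Z => by simpa using hD.2.1 φ hφ z hz u v Z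

theorem IsShenType.connForm_symm (hz : z ∈ slitDomain φ) (u v : E n × E n) :
    D.connForm φ z u v.1 = D.connForm φ z v u.1 :=
  sub_eq_zero.1 ((torsion_eq u v).symm.trans (hD.torsion_eq_zero hφ hz u v))

/-- Apply the symmetry to (0, Y) and (X, 0): the other side is the connection form evaluated on the
zero section value. -/
theorem IsShenType.connForm_vertical (hz : z ∈ slitDomain φ) (Y : E n) :
    D.connForm φ z (0, Y) = 0 := by
  ext1 X
  simpa using hD.connForm_symm hφ hz (0, Y) (X, 0)

theorem IsShenType.connForm_eq (hz : z ∈ slitDomain φ) (u : E n × E n) :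
    D.connForm φ z u = D.connForm φ z (u.1, 0) := by
  have h : u = (u.1, 0) + (0, u.2) := by simp
  conv_lhs => rw [h]
  rw [map_add, hD.connForm_vertical hφ hz, add_zero]

theorem IsShenType.μV_eq (hz : z ∈ slitDomain φ) :
    D.μV φ z = ContinuousLinearMap.id ℝ (E n) := by
  ext1 Y
  simp [μV, μ_apply, hD.connForm_vertical hφ hz]

theorem IsShenType.verticalLift_eq (hz : z ∈ slitDomain φ) (Y : E n) :
    D.verticalLift φ z Y = (0, Y) := by
  simp [verticalLift, hD.μV_eq hφ hz]

theorem IsShenType.horizontalLift_eq (hz : z ∈ slitDomain φ) (X : E n) :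
    D.horizontalLift φ z X = (X, -D.connForm φ z (X, 0) z.2) := by
  simp [horizontalLift, hD.verticalLift_eq hφ hz, μ_apply]

theorem IsShenType.connForm_horizontalLift (hz : z ∈ slitDomain φ) (X : E n) :
    D.connForm φ z (D.horizontalLift φ z X) = D.connForm φ z (X, 0) := by
  rw [hD.connForm_eq hφ hz, hD.horizontalLift_eq hφ hz]

theorem IsShenType.μ_horizontalLift (hz : z ∈ slitDomain φ) (X : E n) :
    D.μ φ z (D.horizontalLift φ z X) = 0 := by
  rw [μ_apply, hD.connForm_horizontalLift hφ hz, hD.horizontalLift_eq hφ hz]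
  simp

theorem IsShenType.fderiv_connForm_vertical (hz : z ∈ slitDomain φ) (u : E n × E n) (Y : E n) :
    fderiv ℝ (D.connForm φ) z u (0, Y) = 0 := by
  have hU := isOpen_slitDomain φ
  rw [← fderiv_apply_const (D.contDiffOn_connForm hφ) hU hz,
    fderiv_eq_zero_of_eqOn_zero (fun z' hz' => hD.connForm_vertical hφ hz' Y) hU hz]
  rfl

/-- The form and its derivatives kill vertical vectors, so the quadratic terms and one derivative
drop out, as does the vertical part of the horizontal lift. -/
theorem IsShenType.hvCurvature_eq (hz : z ∈ slitDomain φ) (X Y ζ : E n) :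
    D.hvCurvature φ z X Y ζ = -fderiv ℝ (D.connForm φ) z (0, Y) (X, 0) ζ := by
  have h : ((X, -D.connForm φ z (X, 0) z.2) : E n × E n) =
    (X, 0) + (0, -D.connForm φ z (X, 0) z.2) := by simp
  rw [hvCurvature, curvature_eq hφ hz, hD.verticalLift_eq hφ hz, hD.horizontalLift_eq hφ hz,
    hD.fderiv_connForm_vertical hφ hz, hD.connForm_vertical hφ hz, h, map_add,
    hD.fderiv_connForm_vertical hφ hz]
  simp

theorem IsShenType.contDiffOn_ellBar : ContDiffOn ℝ ∞ (D.ellBar φ F) (slitDomain φ) := by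
  have h1 : ContDiffOn ℝ ∞ (fun z : E n × E n => (F.loc φ z)⁻¹ • z.2) (slitDomain φ) :=
    ((F.contDiffOn_loc hφ).inv fun z hz => F.loc_ne_zero hφ hz).smul contDiffOn_snd
  have h2 : ContDiffOn ℝ ∞ (fun z : E n × E n => ((F.loc φ z)⁻¹ • z.2,
      -D.connForm φ z ((F.loc φ z)⁻¹ • z.2, 0) z.2)) (slitDomain φ) :=
    h1.prodMk (((D.contDiffOn_connForm hφ).clm_apply
      (h1.prodMk contDiffOn_const)).clm_apply contDiffOn_snd).neg
  exact h2.congr fun z hz => hD.horizontalLift_eq hφ hz _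

end Shen

theorem IsShenType.contDiffOn_covEllBarCLM (hD : D.IsShenType F m κ)
    {T : E n × E n → E n →L[ℝ] E n →L[ℝ] E n →L[ℝ] ℝ}
    (hT : ContDiffOn ℝ ∞ T (slitDomain φ)) :
    ContDiffOn ℝ ∞ (fun z => covEllBarCLM (D.ellBar φ F z)
      (D.connForm φ z (D.ellBar φ F z)) (T z) (fderiv ℝ T z)) (slitDomain φ) := by
  have hL := hD.contDiffOn_ellBar hφ
  have hK := (D.contDiffOn_connForm hφ).clm_apply hL
  have hT' := contDiffOn_fderiv hT (isOpen_slitDomain φ)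
  refine contDiffOn_clm_apply.2 fun X => contDiffOn_clm_apply.2 fun Y =>
    contDiffOn_clm_apply.2 fun Z => ?_
  simp only [covEllBarCLM_apply]
  have hX : ContDiffOn ℝ ∞ (fun _ : E n × E n => X) (slitDomain φ) := contDiffOn_const
  have hY : ContDiffOn ℝ ∞ (fun _ : E n × E n => Y) (slitDomain φ) := contDiffOn_const
  have hZ : ContDiffOn ℝ ∞ (fun _ : E n × E n => Z) (slitDomain φ) := contDiffOn_const
  exact (((((hT'.clm_apply hL).clm_apply hX).clm_apply hY).clm_apply hZ).sub
    (((hT.clm_apply (hK.clm_apply hX)).clm_apply hY).clm_apply hZ)).sub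
    (((hT.clm_apply hX).clm_apply (hK.clm_apply hY)).clm_apply hZ) |>.sub
    (((hT.clm_apply hX).clm_apply hY).clm_apply (hK.clm_apply hZ))

theorem cartan_eq_cartanCLM (hz : z ∈ slitDomain φ) (X Y Z : E n) :
    F.cartan φ z X Y Z = cartanCLM F φ z X Y Z := by
  have hU := isOpen_slitDomain φ
  have h := F.contDiffOn_sq hφ
  rw [F.cartan_eq hφ hz, cartanCLM_apply,
    fderiv_fderiv_comm (contDiffOn_fderiv h hU) hU hz (0, Z),
    fderiv_three_swap h hU hz _ (0, Z), fderiv_fderiv_comm (contDiffOn_fderiv h hU) hU hz (0, Y)]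

theorem contDiffOn_cartanCLM : ContDiffOn ℝ ∞ (cartanCLM F φ) (slitDomain φ) := by
  refine contDiffOn_clm_apply.2 fun X => contDiffOn_clm_apply.2 fun Y =>
    contDiffOn_clm_apply.2 fun Z => ?_
  simp only [cartanCLM_apply]
  exact (contDiffOn_const.mul (F.contDiffOn_loc hφ)).mul
    ((((F.contDiffOn_fderiv_three_sq hφ).clm_apply contDiffOn_const).clm_apply
      contDiffOn_const).clm_apply contDiffOn_const)

/-- The iterated derivatives of the Cartan tensor are smooth trilinear forms that vanish on the
canonical section. -/
theorem IsShenType.exists_cartanDeriv_eq (hD : D.IsShenType F m κ) (i : ℕ) :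
    ∃ T : E n × E n → E n →L[ℝ] E n →L[ℝ] E n →L[ℝ] ℝ, ContDiffOn ℝ ∞ T (slitDomain φ) ∧
      (∀ z ∈ slitDomain φ, ∀ X Y Z, D.cartanDeriv φ F i z X Y Z = T z X Y Z) ∧
      ∀ z ∈ slitDomain φ, ∀ X Z, T z X z.2 Z = 0 := by
  have hU := isOpen_slitDomain φ
  induction i with
  | zero =>
    refine ⟨cartanCLM F φ, contDiffOn_cartanCLM hφ, fun z hz => cartan_eq_cartanCLM hφ hz,
      fun z hz X Z => ?_⟩
    rw [cartanCLM_apply, fderiv_three_swap (F.contDiffOn_sq hφ) hU hz,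
      F.fderiv_three_sq_euler hφ hz, mul_zero]
  | succ i ih =>
    obtain ⟨T, hT, hB, h0⟩ := ih
    refine ⟨_, hD.contDiffOn_covEllBarCLM hφ hT, fun z hz => covEllBar_eq hT hB hz,
      fun z hz X Z => ?_⟩
    -- Differentiate T(X, y, Z) = 0 along ℓ̄, with y varying.
    have h1 := (((hasFDerivAt_of_contDiffOn hT hU hz).clm_apply (hasFDerivAt_const X z)).clm_apply
      (hasFDerivAt_snd (𝕜 := ℝ) (p := z))).clm_apply (hasFDerivAt_const Z z) |>.fderiv
    rw [fderiv_eq_zero_of_eqOn_zero (fun z hz => h0 z hz X Z) hU hz] at h1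
    have h2 := congrArg (fun L => L (D.ellBar φ F z)) h1
    simp at h2
    -- This says D_ℓ̄ y = 0, so the property passes from T to its derivative.
    have h3 : (D.ellBar φ F z).2 = -D.connForm φ z (D.ellBar φ F z) z.2 := by
      rw [ellBar, hD.connForm_horizontalLift hφ hz, hD.horizontalLift_eq hφ hz]
    rw [h3, map_neg] at h2
    simp at h2
    rw [covEllBarCLM_apply, h0 z hz, h0 z hz]
    linarith

/-- `F` is constant along horizontal curves of a Shen-type connection. -/
theorem IsShenType.fderiv_sq_horizontalLift (hD : D.IsShenType F m κ) (hz : z ∈ slitDomain φ)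
    (X : E n) : fderiv ℝ (F.sq φ) z (D.horizontalLift φ z X) = 0 := by
  have hU := isOpen_slitDomain φ
  have h0 : ∀ i, D.cartanDeriv φ F i z X z.2 z.2 = 0 := fun i => by
    obtain ⟨T, -, hB, h0⟩ := hD.exists_cartanDeriv_eq hφ i
    rw [hB z hz, h0 z hz]
  -- On (y, y) the right side vanishes: all A^{(i)} annihilate y and `μ` kills horizontal vectors.
  -- The Euler relations reduce the left side to df(h).
  have h1 := hD.2.2 φ hφ z hz (D.horizontalLift φ z X) z.2 z.2
  have h2 : (D.horizontalLift φ z X).1 = X := by rw [hD.horizontalLift_eq hφ hz]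
  have h3 : F.cartan φ z X z.2 z.2 = 0 := h0 0
  simp only [hD.μ_horizontalLift hφ hz, h2, h0, h3, cartan_eq_cartanCLM hφ hz, map_zero] at h1
  simp only [covMetric, cov_const, hD.connForm_horizontalLift hφ hz] at h1
  rw [F.fderiv_g hφ hz, F.fderiv_three_sq_canonical hφ hz, F.g_eq hφ hz, F.g_eq hφ hz,
    F.fderiv_two_sq_canonical hφ hz,
    fderiv_fderiv_comm (F.contDiffOn_sq hφ) hU hz _ (0, D.connForm φ z (X, 0) z.2),
    F.fderiv_two_sq_euler hφ hz, F.fderiv_two_sq_euler hφ hz] at h1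
  have h4 : ((0, (D.horizontalLift φ z X).2) : E n × E n) =
      -(0, D.connForm φ z (X, 0) z.2) := by
    rw [hD.horizontalLift_eq hφ hz]
    simp
  rw [h4, map_neg] at h1
  simp at h1
  linarith

end PullbackConnection

/-! ### Riemannian means vanishing third fibre derivatives of F². -/

theorem fderiv_vertical_eq_zero {n : ℕ} {f : E n × E n → ℝ} {z : E n × E n}
    (hf : DifferentiableAt ℝ f z) (hz : z.2 ≠ 0) (h : ∀ y, y ≠ 0 → f (z.1, y) = f z) (w : E n) :
    fderiv ℝ f z (0, w) = 0 := by
  have h1 : HasFDerivAt (fun y => f (z.1, y))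
      ((fderiv ℝ f z).comp (ContinuousLinearMap.inr ℝ (E n) (E n))) z.2 :=
    hf.hasFDerivAt.comp z.2 (hasFDerivAt_prodMk_right z.1 z.2)
  have h2 : HasFDerivAt (fun y => f (z.1, y)) (0 : E n →L[ℝ] ℝ) z.2 :=
    (hasFDerivAt_const (f z) z.2).congr_of_eventuallyEq
      ((isOpen_ne.eventually_mem hz).mono fun y hy => h y hy)
  simpa using congrArg (fun L => L w) (h1.unique h2)

variable {n : ℕ} {M : Type*} [TopologicalSpace M] [ChartedSpace (E n) M] [IsManifold (𝓡 n) ∞ M]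

theorem FinslerStructure.isRiemannian_iff (hn : n ≠ 1) (F : FinslerStructure n M) :
    F.IsRiemannian ↔ ∀ φ ∈ charts n M, ∀ z ∈ slitDomain φ, ∀ u v w : E n,
      fderiv ℝ (fderiv ℝ (fderiv ℝ (F.sq φ))) z (0, u) (0, v) (0, w) = 0 := by
  have hd : ∀ φ ∈ charts n M, ∀ z ∈ slitDomain φ, ∀ u v : E n,
      DifferentiableAt ℝ (fun z' => F.g φ z' u v) z := fun φ hφ z hz u v => by
    have h := (hasFDerivAt_of_contDiffOn (((F.contDiffOn_fderiv_two_sq hφ).clm_apply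
      (contDiffOn_const (c := ((0, v) : E n × E n)))).clm_apply
        (contDiffOn_const (c := ((0, u) : E n × E n)))) (isOpen_slitDomain φ) hz).const_mul (1 / 2)
    refine (h.congr_of_eventuallyEq ?_).differentiableAt
    filter_upwards [(isOpen_slitDomain φ).mem_nhds hz] with z' hz'
    exact F.g_eq hφ hz' u v
  constructor
  · intro hR φ hφ z hz u v w
    have h := fderiv_vertical_eq_zero (hd φ hφ z hz w v) hz.2
      (fun y hy => hR φ hφ z.1 hz.1 y z.2 hy hz.2 w v) u
    rw [F.fderiv_g hφ hz] at h
    simpa using h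
  · intro hA φ hφ x hx y y' hy hy' u v
    -- For n = 0 there is no nonzero y; for n = 1 the slit fibre would be disconnected.
    have hn1 : 1 < n := by
      rcases n with _ | _ | n
      · exact absurd (Subsingleton.elim y 0) hy
      · exact absurd rfl hn
      · omega
    have hconn : IsPreconnected ({0}ᶜ : Set (E n)) :=
      (isConnected_compl_singleton_of_one_lt_rank
        (by rw [rank_eq_card_basis (EuclideanSpace.basisFun (Fin n) ℝ).toBasis]
            simpa using hn1) 0).isPreconnected
    have h1 : ∀ y : E n, y ≠ 0 → HasFDerivAt (fun y => F.g φ (x, y) u v) (0 : E n →L[ℝ] ℝ) y := by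
      intro y hy
      have hz : (x, y) ∈ slitDomain φ := ⟨hx, hy⟩
      have h2 := (hd φ hφ (x, y) hz u v).hasFDerivAt.comp y (hasFDerivAt_prodMk_right x y)
      refine h2.congr_fderiv ?_
      ext1 w
      have h3 := F.fderiv_g hφ hz u v (0, w)
      rw [hA φ hφ _ hz, mul_zero] at h3
      simpa using h3
    exact isOpen_compl_singleton.is_const_of_fderiv_eq_zero (𝕜 := ℝ) hconn
      (fun y hy => (h1 y hy).differentiableAt.differentiableWithinAt)
      (fun y hy => (h1 y hy).fderiv) hy hy'

/-! ### From A = 0 to a connection form constant on the fibres. -/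

namespace PullbackConnection

variable {D : PullbackConnection n M} {F : FinslerStructure n M} {m : ℕ} {κ : ℕ → ℝ}
  {φ : OpenPartialHomeomorph M (E n)} {z : E n × E n}

/-- The recursion is linear in the tensor and local, so vanishing on the open domain propagates to
all later derivatives. -/
theorem cartanDeriv_add_eq_zero {i : ℕ}
    (h : ∀ z ∈ slitDomain φ, ∀ X Y Z, D.cartanDeriv φ F i z X Y Z = 0) (j : ℕ) :
    ∀ z ∈ slitDomain φ, ∀ X Y Z, D.cartanDeriv φ F (i + j) z X Y Z = 0 := by
  induction j with
  | zero => exact h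
  | succ j ih =>
    intro z hz X Y Z
    have h1 : fderiv ℝ (fun z' => D.cartanDeriv φ F (i + j) z' X Y Z) z = 0 :=
      fderiv_eq_zero_of_eqOn_zero (fun z' hz' => ih z' hz' X Y Z) (isOpen_slitDomain φ) hz
    simp [cartanDeriv, covEllBar, h1, ih z hz]

section Shen

variable (hφ : φ ∈ charts n M) (hD : D.IsShenType F m κ)

include hφ

theorem exists_hasFDerivAt_connForm (hz : z ∈ slitDomain φ) (X Y : E n) :
    ∃ L : (E n × E n) →L[ℝ] (E n × E n), HasFDerivAt (fun z' => ((0, D.connForm φ z' (X, 0) Y) : E n × E n)) L z ∧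
      ∀ w, L w = (0, fderiv ℝ (D.connForm φ) z w (X, 0) Y) := by
  have h := hasFDerivAt_of_contDiffOn (D.contDiffOn_connForm hφ) (isOpen_slitDomain φ) hz
  have h1 := (h.clm_apply (hasFDerivAt_const ((X, 0) : E n × E n) z)).clm_apply
    (hasFDerivAt_const Y z)
  exact ⟨_, (hasFDerivAt_const (0 : E n) z).prodMk h1, fun w => by simp⟩

include hD

theorem IsShenType.exists_hasFDerivAt_horizontalLift (hz : z ∈ slitDomain φ) (X : E n) :
    ∃ L : (E n × E n) →L[ℝ] (E n × E n), HasFDerivAt (fun z' => D.horizontalLift φ z' X) L z ∧ ∀ w, L w =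
      (0, -(D.connForm φ z (X, 0) w.2 + fderiv ℝ (D.connForm φ) z w (X, 0) z.2)) := by
  have hU := isOpen_slitDomain φ
  have h := hasFDerivAt_of_contDiffOn (D.contDiffOn_connForm hφ) hU hz
  have h1 := (h.clm_apply (hasFDerivAt_const ((X, 0) : E n × E n) z)).clm_apply
    (hasFDerivAt_snd (𝕜 := ℝ) (p := z))
  refine ⟨_, ((hasFDerivAt_const X z).prodMk h1.neg).congr_of_eventuallyEq ?_, fun w => by simp⟩
  filter_upwards [hU.mem_nhds hz] with z' hz'
  exact hD.horizontalLift_eq hφ hz' X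

theorem IsShenType.covMetric_horizontalLift (hz : z ∈ slitDomain φ) (X Y Z : E n) :
    D.covMetric φ F z (D.horizontalLift φ z X) Y Z =
      1 / 2 * (fderiv ℝ (fderiv ℝ (fderiv ℝ (F.sq φ))) z (D.horizontalLift φ z X) (0, Z) (0, Y)
        - fderiv ℝ (fderiv ℝ (F.sq φ)) z (0, Z) (0, D.connForm φ z (X, 0) Y)
        - fderiv ℝ (fderiv ℝ (F.sq φ)) z (0, D.connForm φ z (X, 0) Z) (0, Y)) := by
  simp only [covMetric, cov_const, hD.connForm_horizontalLift hφ hz, F.fderiv_g hφ hz,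
    F.g_eq hφ hz]
  ring

/-- If the Cartan tensor vanishes, the connection form is constant on the fibres. -/
theorem IsShenType.fderiv_connForm_eq_zero
    (hA : ∀ z ∈ slitDomain φ, ∀ u v w : E n,
      fderiv ℝ (fderiv ℝ (fderiv ℝ (F.sq φ))) z (0, u) (0, v) (0, w) = 0)
    (hz : z ∈ slitDomain φ) (W X Y : E n) :
    fderiv ℝ (D.connForm φ) z (0, W) (X, 0) Y = 0 := by
  have hU := isOpen_slitDomain φ
  have hf := F.contDiffOn_sq hφ
  have hf1 := F.contDiffOn_fderiv_sq hφ
  have hf2 := F.contDiffOn_fderiv_two_sq hφ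
  have hf3 := F.contDiffOn_fderiv_three_sq hφ
  have hcartan : ∀ z ∈ slitDomain φ, ∀ X Y Z, D.cartanDeriv φ F 0 z X Y Z = 0 :=
    fun z hz X Y Z => (F.cartan_eq_zero_iff hφ hz X Y Z).2 (hA z hz Z Y X)
  have hc : ∀ i, ∀ z ∈ slitDomain φ, ∀ X Y Z, D.cartanDeriv φ F i z X Y Z = 0 := fun i => by
    simpa using cartanDeriv_add_eq_zero hcartan i
  -- D_h g = 0 written out; the vertical part of h contributes nothing since g is constant in y.
  have hk : ∀ z ∈ slitDomain φ, ∀ X Y Z,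
      fderiv ℝ (fderiv ℝ (fderiv ℝ (F.sq φ))) z (X, 0) (0, Z) (0, Y) =
        fderiv ℝ (fderiv ℝ (F.sq φ)) z (0, Z) (0, D.connForm φ z (X, 0) Y) +
        fderiv ℝ (fderiv ℝ (F.sq φ)) z (0, D.connForm φ z (X, 0) Z) (0, Y) := by
    intro z hz X Y Z
    have h1 := hD.2.2 φ hφ z hz (D.horizontalLift φ z X) Y Z
    have h0 : ∀ X Y Z, F.cartan φ z X Y Z = 0 := hcartan z hz
    rw [hD.covMetric_horizontalLift hφ hz] at h1
    have h2 : D.horizontalLift φ z X = (X, 0) + (0, -D.connForm φ z (X, 0) z.2) := by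
      rw [hD.horizontalLift_eq hφ hz]
      simp
    rw [h2] at h1
    simp only [map_add, h0, hc _ z hz, add_apply, hA z hz] at h1
    simp at h1
    linarith
  have hk' : ∀ X Y Z,
      fderiv ℝ (fderiv ℝ (F.sq φ)) z (0, Z) (0, fderiv ℝ (D.connForm φ) z (0, W) (X, 0) Y) +
      fderiv ℝ (fderiv ℝ (F.sq φ)) z (0, fderiv ℝ (D.connForm φ) z (0, W) (X, 0) Z) (0, Y) = 0 := by
    intro X Y Z
    obtain ⟨LY, hLY, hLY'⟩ := exists_hasFDerivAt_connForm (D := D) hφ hz X Y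
    obtain ⟨LZ, hLZ, hLZ'⟩ := exists_hasFDerivAt_connForm (D := D) hφ hz X Z
    have h2 := hasFDerivAt_of_contDiffOn hf2 hU hz
    have h3 := (((h2.clm_apply (hasFDerivAt_const ((0, Z) : E n × E n) z)).clm_apply hLY).add
      ((h2.clm_apply hLZ).clm_apply (hasFDerivAt_const ((0, Y) : E n × E n) z))).fderiv
    have h4 := fderiv_congr_of_eqOn (fun z' hz' => hk z' hz' X Y Z) hU hz
    have h5 := congrArg (fun L => L (0, W)) (h4.trans h3)
    beta_reduce at h5
    -- Exchanging (0, W) with (X, 0) exhibits the left side as the x-derivative of a third fibre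
    -- derivative, which is identically zero.
    rw [fderiv_apply_const₃ hf3 hU hz, fderiv_fderiv_comm hf2 hU hz, ← fderiv_apply_const₃ hf3 hU hz,
      fderiv_eq_zero_of_eqOn_zero (fun z' hz' => hA z' hz' W Z Y) hU hz] at h5
    simp [hLY', hLZ', hA z hz] at h5
    linarith
  have hs : ∀ X Y, fderiv ℝ (D.connForm φ) z (0, W) (X, 0) Y =
      fderiv ℝ (D.connForm φ) z (0, W) (Y, 0) X := fun X Y => by
    have h := D.contDiffOn_connForm hφ
    rw [← fderiv_apply_const₂ h hU hz, ← fderiv_apply_const₂ h hU hz,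
      fderiv_congr_of_eqOn (fun z' hz' => hD.connForm_symm hφ hz' (X, 0) (Y, 0)) hU hz]
  refine F.eq_zero_of_g_eq_zero hφ hz fun Z => ?_
  rw [F.g_eq hφ hz]
  have hc2 := fun a b => fderiv_fderiv_comm hf hU hz (0, a) (0, b)
  have e1 := hk' X Y Z
  have e2 := hk' Y Z X
  have e3 := hk' Z X Y
  rw [hc2 _ Y] at e1
  rw [hc2 _ Z] at e2
  rw [hc2 _ X] at e3
  rw [hs Y Z, hs Y X] at e2
  rw [hs Z X] at e3
  linarith

/-! ### From a connection form constant on the fibres to A = 0. -/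

section Berwald

variable (hP : ∀ z ∈ slitDomain φ, ∀ W X Y : E n,
  fderiv ℝ (D.connForm φ) z (0, W) (X, 0) Y = 0)

include hP

/-- Fibre derivative of df(h) = 0. As Γ is constant in y, the derivative of h along (0, Y) is just
(0, -Γ(X)Y). -/
theorem IsShenType.fderiv_two_sq_horizontalLift (hz : z ∈ slitDomain φ) (X Y : E n) :
    fderiv ℝ (fderiv ℝ (F.sq φ)) z (0, Y) (D.horizontalLift φ z X) =
      fderiv ℝ (F.sq φ) z (0, D.connForm φ z (X, 0) Y) := by
  have hU := isOpen_slitDomain φ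
  obtain ⟨L, hL, hL'⟩ := hD.exists_hasFDerivAt_horizontalLift hφ hz X
  have h1 := ((hasFDerivAt_of_contDiffOn (F.contDiffOn_fderiv_sq hφ) hU hz).clm_apply hL).fderiv
  rw [fderiv_eq_zero_of_eqOn_zero (fun z' hz' => hD.fderiv_sq_horizontalLift hφ hz' X) hU hz] at h1
  have h2 := congrArg (fun L => L (0, Y)) h1
  have h3 : ∀ v : E n, ((0, -v) : E n × E n) = -(0, v) := fun v => by simp
  have h4 : ((0, 0) : E n × E n) = 0 := rfl
  simp [hL', hP z hz] at h2
  rw [h3, map_neg] at h2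
  linarith

/-- A second fibre derivative; the outcome is D_h g = 0. -/
theorem IsShenType.fderiv_three_sq_horizontalLift (hz : z ∈ slitDomain φ) (X Y Z : E n) :
    fderiv ℝ (fderiv ℝ (fderiv ℝ (F.sq φ))) z (0, Z) (0, Y) (D.horizontalLift φ z X) =
      fderiv ℝ (fderiv ℝ (F.sq φ)) z (0, Y) (0, D.connForm φ z (X, 0) Z) +
      fderiv ℝ (fderiv ℝ (F.sq φ)) z (0, Z) (0, D.connForm φ z (X, 0) Y) := by
  have hU := isOpen_slitDomain φ
  obtain ⟨L, hL, hL'⟩ := hD.exists_hasFDerivAt_horizontalLift hφ hz X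
  obtain ⟨LY, hLY, hLY'⟩ := exists_hasFDerivAt_connForm (D := D) hφ hz X Y
  have hf1 := hasFDerivAt_of_contDiffOn (F.contDiffOn_fderiv_sq hφ) hU hz
  have hf2 := hasFDerivAt_of_contDiffOn (F.contDiffOn_fderiv_two_sq hφ) hU hz
  have h1 := ((hf2.clm_apply (hasFDerivAt_const ((0, Y) : E n × E n) z)).clm_apply hL).fderiv
  rw [fderiv_congr_of_eqOn (fun z' hz' => hD.fderiv_two_sq_horizontalLift hφ hP hz' X Y) hU hz,
    (hf1.clm_apply hLY).fderiv] at h1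
  have h2 := congrArg (fun L => L (0, Z)) h1
  have h3 : ∀ v : E n, ((0, -v) : E n × E n) = -(0, v) := fun v => by simp
  have h4 : ((0, 0) : E n × E n) = 0 := rfl
  simp [hL', hLY', hP z hz, h4] at h2
  rw [h3, map_neg] at h2
  linarith

/-- A third fibre derivative: the tensor f_yyy is horizontally parallel. -/
theorem IsShenType.fderiv_four_sq_horizontalLift (hz : z ∈ slitDomain φ) (X Y Z W : E n) :
    fderiv ℝ (fderiv ℝ (fderiv ℝ (fderiv ℝ (F.sq φ)))) z (0, W) (0, Z) (0, Y)
        (D.horizontalLift φ z X) =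
      fderiv ℝ (fderiv ℝ (fderiv ℝ (F.sq φ))) z (0, Z) (0, Y) (0, D.connForm φ z (X, 0) W) +
      fderiv ℝ (fderiv ℝ (fderiv ℝ (F.sq φ))) z (0, W) (0, Y) (0, D.connForm φ z (X, 0) Z) +
      fderiv ℝ (fderiv ℝ (fderiv ℝ (F.sq φ))) z (0, W) (0, Z) (0, D.connForm φ z (X, 0) Y) := by
  have hU := isOpen_slitDomain φ
  obtain ⟨L, hL, hL'⟩ := hD.exists_hasFDerivAt_horizontalLift hφ hz X
  obtain ⟨LY, hLY, hLY'⟩ := exists_hasFDerivAt_connForm (D := D) hφ hz X Y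
  obtain ⟨LZ, hLZ, hLZ'⟩ := exists_hasFDerivAt_connForm (D := D) hφ hz X Z
  have hf2 := hasFDerivAt_of_contDiffOn (F.contDiffOn_fderiv_two_sq hφ) hU hz
  have hf3 := hasFDerivAt_of_contDiffOn (F.contDiffOn_fderiv_three_sq hφ) hU hz
  have hY : HasFDerivAt (fun _ : E n × E n => ((0, Y) : E n × E n))
      (0 : (E n × E n) →L[ℝ] (E n × E n)) z := hasFDerivAt_const _ z
  have hZ : HasFDerivAt (fun _ : E n × E n => ((0, Z) : E n × E n))
      (0 : (E n × E n) →L[ℝ] (E n × E n)) z := hasFDerivAt_const _ z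
  have h1 := (((hf3.clm_apply hZ).clm_apply hY).clm_apply hL).fderiv
  rw [fderiv_congr_of_eqOn (fun z' hz' => hD.fderiv_three_sq_horizontalLift hφ hP hz' X Y Z) hU hz]
    at h1
  have h2 := congrArg (fun L => L (0, W)) (h1.symm.trans
    (((hf2.clm_apply hY).clm_apply hLZ).add ((hf2.clm_apply hZ).clm_apply hLY)).fderiv)
  have h3 : ∀ v : E n, ((0, -v) : E n × E n) = -(0, v) := fun v => by simp
  have h4 : ((0, 0) : E n × E n) = 0 := rfl
  simp [hL', hLY', hLZ', hP z hz, h4] at h2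
  rw [h3, map_neg] at h2
  linarith

/-- A is F/4 times f_yyy, and both factors are horizontally parallel. -/
theorem IsShenType.cartanDeriv_one_eq_zero (hz : z ∈ slitDomain φ) (X Y Z : E n) :
    D.cartanDeriv φ F 1 z X Y Z = 0 := by
  have hU := isOpen_slitDomain φ
  have hf := F.contDiffOn_sq hφ
  have hf1 := F.contDiffOn_fderiv_sq hφ
  have hf2 := F.contDiffOn_fderiv_two_sq hφ
  have hf3 := F.contDiffOn_fderiv_three_sq hφ
  have hF := hasFDerivAt_of_contDiffOn (F.contDiffOn_loc hφ) hU hz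
  -- Only the horizontality of ℓ̄ matters, so V = y/F is kept opaque.
  obtain ⟨V, hV⟩ : ∃ V, D.ellBar φ F z = D.horizontalLift φ z V := ⟨_, rfl⟩
  have h0 : fderiv ℝ (F.loc φ) z (D.ellBar φ F z) = 0 := by
    have h1 := hD.fderiv_sq_horizontalLift hφ hz V
    have h2 : fderiv ℝ (F.sq φ) z = _ := (hF.pow 2).fderiv
    rw [h2, ← hV] at h1
    simpa [F.loc_ne_zero hφ hz] using h1
  have h1 : fderiv ℝ (fun z' => F.cartan φ z' X Y Z) z (D.ellBar φ F z) =
      1 / 4 * F.loc φ z * fderiv ℝ (fderiv ℝ (fderiv ℝ (fderiv ℝ (F.sq φ)))) z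
        (D.ellBar φ F z) (0, Z) (0, Y) (0, X) := by
    have h2 := hasFDerivAt_of_contDiffOn (((hf3.clm_apply
      (contDiffOn_const (c := ((0, Z) : E n × E n)))).clm_apply
      (contDiffOn_const (c := ((0, Y) : E n × E n)))).clm_apply
      (contDiffOn_const (c := ((0, X) : E n × E n)))) hU hz
    rw [fderiv_congr_of_eqOn (fun z' hz' => F.cartan_eq hφ hz' X Y Z) hU hz,
      ← fderiv_apply_const₃ hf3 hU hz]
    refine (congrArg (fun L => L (D.ellBar φ F z)) ((hF.const_mul (1 / 4)).mul h2).fderiv).trans ?_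
    simp [h0]
  have h2 : fderiv ℝ (fderiv ℝ (fderiv ℝ (fderiv ℝ (F.sq φ)))) z (D.ellBar φ F z) (0, Z) (0, Y)
      (0, X) = fderiv ℝ (fderiv ℝ (fderiv ℝ (fderiv ℝ (F.sq φ)))) z (0, Z) (0, Y) (0, X)
      (D.ellBar φ F z) := by
    rw [fderiv_fderiv_comm hf2 hU hz, fderiv_three_swap hf1 hU hz, fderiv_four_swap hf hU hz]
  have e1 : ∀ a b c, fderiv ℝ (fderiv ℝ (fderiv ℝ (F.sq φ))) z a b c =
    fderiv ℝ (fderiv ℝ (fderiv ℝ (F.sq φ))) z b a c :=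
    fun a b c => by rw [fderiv_fderiv_comm hf1 hU hz]
  have e2 := fderiv_three_swap hf hU hz
  have h3 := hD.fderiv_four_sq_horizontalLift hφ hP hz V X Y Z
  rw [← hV] at h3
  have h4 := hD.connForm_horizontalLift hφ hz V
  rw [← hV] at h4
  simp only [cartanDeriv, covEllBar, cov_const, h1, h2, h3, h4, F.cartan_eq hφ hz]
  rw [e2 _ (0, D.connForm φ z (V, 0) Y), e1 (0, D.connForm φ z (V, 0) Z), e2 _ _ (0, X),
    e2 _ (0, X)]
  ring

theorem IsShenType.fderiv_three_sq_eq_zero (hz : z ∈ slitDomain φ) (X Y Z : E n) :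
    fderiv ℝ (fderiv ℝ (fderiv ℝ (F.sq φ))) z (0, X) (0, Y) (0, Z) = 0 := by
  have hU := isOpen_slitDomain φ
  have hf := F.contDiffOn_sq hφ
  have hf1 := F.contDiffOn_fderiv_sq hφ
  -- The sum starts at i = 1, so Ȧ = 0 kills S although A itself is not yet known to vanish;
  -- compatibility then leaves 0 = 2A.
  have hS : ∀ i ∈ Finset.Icc 1 m, κ i * D.cartanDeriv φ F i z Z Y X = 0 := fun i hi => by
    obtain ⟨j, rfl⟩ := Nat.exists_eq_add_of_le (Finset.mem_Icc.1 hi).1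
    rw [cartanDeriv_add_eq_zero
      (fun z hz X Y Z => hD.cartanDeriv_one_eq_zero hφ hP hz X Y Z) j z hz, mul_zero]
  have h1 := hD.2.2 φ hφ z hz (D.horizontalLift φ z Z) Y X
  have h2 : (D.horizontalLift φ z Z).1 = Z := by rw [hD.horizontalLift_eq hφ hz]
  beta_reduce at h1
  rw [hD.covMetric_horizontalLift hφ hz, h2, Finset.sum_eq_zero hS,
    hD.μ_horizontalLift hφ hz, fderiv_fderiv_comm hf1 hU hz, fderiv_three_swap hf hU hz,
    hD.fderiv_three_sq_horizontalLift hφ hP hz,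
    fderiv_fderiv_comm hf hU hz (0, D.connForm φ z (Z, 0) X)] at h1
  simp only [cartan_eq_cartanCLM hφ hz, map_zero] at h1
  rw [← F.cartan_eq_zero_iff hφ hz, cartan_eq_cartanCLM hφ hz]
  simp at h1
  linarith

end Berwald

end Shen

end PullbackConnection

end Finsler

theorem mainTheorem3 {n : ℕ} (hn : n ≠ 1) {M : Type*} [TopologicalSpace M]
    [ChartedSpace (Finsler.E n) M] [IsManifold (𝓡 n) ∞ M]
    (F : Finsler.FinslerStructure n M) (m : ℕ) (κ : ℕ → ℝ)
    (D : Finsler.PullbackConnection n M) (hD : D.IsShenType F m κ) :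
    D.HVCurvatureVanishes ↔ F.IsRiemannian := by
  rw [F.isRiemannian_iff hn]
  constructor
  · intro hP φ hφ z hz u v w
    refine hD.fderiv_three_sq_eq_zero hφ (fun z hz W X Y => ?_) hz u v w
    have h := hP φ hφ z hz X W Y
    rwa [hD.hvCurvature_eq hφ hz, neg_eq_zero] at h
  · intro hA φ hφ z hz X Y ζ
    rw [hD.hvCurvature_eq hφ hz, hD.fderiv_connForm_eq_zero hφ (hA φ hφ) hz, neg_zero]
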